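/- Let $E/F$ be a CM extension of number fields ($F$ totally real, $E$ totally imaginary, $[E:F]=2$), let $c$ be the nontrivial element of $\mathrm{Gal}(E/F)$, let $\bar E$ be an algebraic closure of $E$, and let $\gamma\in\mathrm{Gal}(\bar E/F)$ be a lift of $c$. For a representation $\rho$ of $\mathrm{Gal}(\bar E/E)$ write $\rho^c$ for the representation $g\mapsto\rho(\gamma g\gamma^{-1})$ (whose isomorphism class does not depend on $\gamma$) and $\rho^*$ for the dual representation. Let $L\subset\mathbb{C}$ be a number field stable under complex conjugation, $\mu$ a finite place of $L$, $L_\mu$ the completion of $L$ at $\mu$ and $\mathcal{O}_\mu$ its ring of integers. Let $\tau$ be a representation of $\mathrm{Gal}(\bar E/E)$ on an $L_\mu$-vector space $V$ of finite dimension $d\le 3$ which stabilizes some $\mathcal{O}_\mu$-lattice of $V$. If $\tau^c\simeq\tau^*$, then there exist a finite totally ramified extension $L'$ of $L_\mu$ with $[L':L_\mu]\le 3$ ($L'=L_\mu$ being allowed), with ring of integers $\mathcal{O}'$, and an $\mathcal{O}'$-lattice $\Lambda$ in $L'\otimes_{L_\mu}V$, stable under $\tau'=\tau\otimes_{L_\mu}L'$,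 such that the representation $\tau'_\Lambda$ over $\mathcal{O}'$ with space $\Lambda$ induced by $\tau'$ satisfies $\tau_\Lambda'^{\,c}\simeq\tau_\Lambda'^{\,*}$ as representations over $\mathcal{O}'$. -/

import Mathlib

open scoped TensorProduct NumberField

noncomputable section

/-- For a lift `γ ∈ Gal(Ω/F)` of an `F`-automorphism `c` of `E`, the automorphism
`g ↦ γ g γ⁻¹` of the group `Gal(Ω/E)`. -/
def galConj {F E Ω : Type*} [Field F] [Field E] [Field Ω] [Algebra F E] [Algebra F Ω]
    [Algebra E Ω] (c : E ≃ₐ[F] E) (γ : Ω ≃ₐ[F] Ω)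
    (hγ : ∀ x : E, γ (algebraMap E Ω x) = algebraMap E Ω (c x)) :
    (Ω ≃ₐ[E] Ω) →* (Ω ≃ₐ[E] Ω) where
  toFun g := AlgEquiv.ofRingEquiv
    (f := (γ.symm.toRingEquiv.trans g.toRingEquiv).trans γ.toRingEquiv) (by
      intro x
      have h : γ.symm (algebraMap E Ω x) = algebraMap E Ω (c.symm x) := by
        rw [AlgEquiv.symm_apply_eq, hγ, AlgEquiv.apply_symm_apply]
      change γ (g (γ.symm (algebraMap E Ω x))) = algebraMap E Ω x
      rw [h, AlgEquiv.commutes, hγ, AlgEquiv.apply_symm_apply])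
  map_one' := by
    ext x
    change γ (γ.symm x) = x
    simp
  map_mul' g h := by
    ext x
    change γ (g (h (γ.symm x))) = γ (g (γ.symm (γ (h (γ.symm x)))))
    simp

/-- The conjugate representation `ρ^c : g ↦ ρ(γ g γ⁻¹)` of a representation `ρ` of `Gal(Ω/E)`,
where `γ ∈ Gal(Ω/F)` is a lift of `c`. -/
def conjRep {F E Ω : Type*} [Field F] [Field E] [Field Ω] [Algebra F E] [Algebra F Ω]
    [Algebra E Ω] {R M : Type*} [CommRing R] [AddCommGroup M] [Module R M]
    (c : E ≃ₐ[F] E) (γ : Ω ≃ₐ[F] Ω)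
    (hγ : ∀ x : E, γ (algebraMap E Ω x) = algebraMap E Ω (c x))
    (ρ : Representation R (Ω ≃ₐ[E] Ω) M) : Representation R (Ω ≃ₐ[E] Ω) M :=
  MonoidHom.comp ρ (galConj c γ hγ)

/-- The `R`-submodule `Λ` is stable under the representation `ρ`. -/
def IsStableUnder {R A G V : Type*} [CommRing R] [CommRing A] [Algebra R A] [Group G]
    [AddCommGroup V] [Module A V] [Module R V] [IsScalarTower R A V]
    (ρ : Representation A G V) (Λ : Submodule R V) : Prop :=
  ∀ g : G, ∀ v ∈ Λ, ρ g v ∈ Λ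

/-- The representation `ρ_Λ` over `R`, with space `Λ`, induced by a representation `ρ` over the
`R`-algebra `A` on a stable `R`-submodule `Λ`. -/
def latticeRep {R A G V : Type*} [CommRing R] [CommRing A] [Algebra R A] [Group G]
    [AddCommGroup V] [Module A V] [Module R V] [IsScalarTower R A V]
    (ρ : Representation A G V) (Λ : Submodule R V) (hΛ : IsStableUnder ρ Λ) :
    Representation R G Λ where
  toFun g := ((ρ g).restrictScalars R).restrict (hΛ g)
  map_one' := by
    ext x
    simp
  map_mul' g h := by
    ext x
    change ρ (g * h) (x : V) = ρ g (ρ h (x : V))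
    rw [map_mul]
    rfl

/-- Extension of scalars of a representation from `A` to an `A`-algebra `B`. -/
def baseChangeRep {A G V : Type*} [CommRing A] [Group G] [AddCommGroup V] [Module A V]
    (B : Type*) [CommRing B] [Algebra A B] (ρ : Representation A G V) :
    Representation B G (TensorProduct A B V) where
  toFun g := (ρ g).baseChange B
  map_one' := by
    rw [map_one]
    exact LinearMap.baseChange_id (R := A) (A := B) (M := V)
  map_mul' g h := by
    rw [map_mul]
    exact LinearMap.baseChange_mul (ρ g) (ρ h)

/-- A finite extension `K'/K` of the fraction field of a local ring `O` (in practice a complete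
discrete valuation ring) is totally ramified when the maximal ideal of `O` generates, in the
integral closure of `O` in `K'`, the `[K' : K]`-th power of a maximal ideal. The trivial
extension is totally ramified. -/
def IsTotallyRamifiedExt (O K K' : Type*) [CommRing O] [IsLocalRing O] [Field K] [Field K']
    [Algebra O K'] [Algebra K K'] : Prop :=
  FiniteDimensional K K' ∧
    ∃ P : Ideal (integralClosure O K'), P.IsMaximal ∧
      (IsLocalRing.maximalIdeal O).map (algebraMap O (integralClosure O K')) =
        P ^ Module.finrank K K'

/-- The representation `ρ` over `A` admits a stable `R`-lattice `Λ` with `ρ_Λ^c ≃ ρ_Λ^*`, the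
isomorphism being one of representations over `R`. Here `ρ_Λ^*` is the `R`-linear dual of
`ρ_Λ`. -/
def HasConjSelfDualLattice {F E Ω : Type*} [Field F] [Field E] [Field Ω] [Algebra F E]
    [Algebra F Ω] [Algebra E Ω] (c : E ≃ₐ[F] E) (γ : Ω ≃ₐ[F] Ω)
    (hγ : ∀ x : E, γ (algebraMap E Ω x) = algebraMap E Ω (c x))
    (R : Type*) {A V : Type*} [CommRing R] [CommRing A] [Algebra R A]
    [AddCommGroup V] [Module A V] [Module R V] [IsScalarTower R A V]
    (ρ : Representation A (Ω ≃ₐ[E] Ω) V) : Prop :=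
  ∃ Λ : Submodule R V, Submodule.IsLattice A Λ ∧ ∃ hΛ : IsStableUnder ρ Λ,
    Nonempty ((conjRep c γ hγ (latticeRep ρ Λ hΛ)).Equiv (latticeRep ρ Λ hΛ).dual)

end

/-!
A conjugate self-dual lattice exists after adjoining a square root of a uniformizer `π`, whatever
the dimension `d`; the trivial extension is never needed.

An isomorphism `τ^c ≃ τ^*` is a nondegenerate form `B` on `V` with
`B (τ (γ g γ⁻¹) v, τ (g) w) = B (v, w)`. Put `s = γ²`, an element of `Gal(Ebar/E)`. The form
`(v, w) ↦ B (τ (s) w, v)` has the same invariance, so it is `B (T v, w)` for an automorphism `T`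
of `τ`, which is an isometry of `B`. As `τ` need not be irreducible, `T` need not be `±1`, but the
Fitting decomposition of `1 + T` is orthogonal and stable; on one summand `1 + T` is invertible, on
the other `1 - T` is. Replacing `B` by its symmetrization on the first and by its
antisymmetrization on the second makes `T` an involution `U` (`exists_form_of_isometry_twist`).
For a lattice `Λ` stable under `τ` and `U`, the left and right duals then agree, so that
`Λ ↦ Λ^∨` is an involution on such lattices.

Starting from `Λ ≤ Λ^∨` with `π ^ n Λ^∨ ≤ Λ`, `n ≥ 2`, the lattice `Λ + π ^ (n - 1) Λ^∨` is still
integral; hence some `Λ` satisfies `π Λ^∨ ≤ Λ ≤ Λ^∨` (`exists_stable_lattice_le_dual`). Over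
`K' = K(x)` with `x² = π`, whose ring of integers is `O ⊕ O x` (`isIntegral_add_mul_iff`), the
lattice `1 ⊗ Λ + x ⊗ Λ^∨` lies halfway between `Λ` and `Λ^∨` and equals its own dual
(`dualSubmodule_ramifiedMidpoint`), so the form induces the required isomorphism.
-/

open LinearMap (BilinForm)

/-! ### Lattices over a domain and their duals -/

open scoped nonZeroDivisors

section Lattices

variable {R A V : Type*} [CommRing R] [Field A] [Algebra R A] [IsFractionRing R A]
  [AddCommGroup V] [Module R V] [Module A V] [IsScalarTower R A V]

/-- A lattice in `V` has `V` as its localization at the nonzero elements of `R`. -/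
lemma isLocalizedModule_subtype_of_isLattice (M : Submodule R V) [Submodule.IsLattice A M] :
    IsLocalizedModule R⁰ M.subtype := by
  have hid : IsLocalizedModule R⁰ (LinearMap.id : V →ₗ[R] V) := isLocalizedModule_id R⁰ V A
  have htop : M.localized' A R⁰ (LinearMap.id : V →ₗ[R] V) = ⊤ := by
    rw [Submodule.localized'_eq_span]
    simpa using Submodule.IsLattice.span_eq_top (A := A) (M := M)
  refine ⟨hid.map_units, fun v ↦ ?_, fun {x y} h ↦ ⟨1, by simpa using h⟩⟩
  have hv : v ∈ M.localized' A R⁰ (LinearMap.id : V →ₗ[R] V) := htop ▸ Submodule.mem_top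
  obtain ⟨m, hm, s, rfl⟩ := (Submodule.mem_localized' _ _ _ _ _).1 hv
  exact ⟨(⟨m, hm⟩, s), IsLocalizedModule.mk'_cancel' _ _ _⟩

lemma exists_dual_extension_of_isLattice (M : Submodule R V) [Submodule.IsLattice A M]
    (f : M →ₗ[R] R) : ∃ F : V →ₗ[A] A, ∀ m : M, F m = algebraMap R A (f m) := by
  have := isLocalizedModule_subtype_of_isLattice (A := A) M
  refine ⟨(IsLocalizedModule.map R⁰ M.subtype (Algebra.linearMap R A) f).extendScalarsOfIsLocalization
    R⁰ A, fun m ↦ ?_⟩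
  exact IsLocalizedModule.map_apply R⁰ M.subtype (Algebra.linearMap R A) f m

variable [IsDomain R]

lemma exists_smul_mem_of_isLattice {M N : Submodule R V} (hM : M.FG)
    [Submodule.IsLattice A N] : ∃ r : R, r ≠ 0 ∧ ∀ v ∈ M, r • v ∈ N := by
  have := isLocalizedModule_subtype_of_isLattice (A := A) N
  induction M, hM using Submodule.fg_induction with
  | singleton v =>
    obtain ⟨⟨m, s⟩, h⟩ := IsLocalizedModule.surj R⁰ N.subtype v
    refine ⟨s, nonZeroDivisors.coe_ne_zero s, fun w hw ↦ ?_⟩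
    obtain ⟨a, rfl⟩ := Submodule.mem_span_singleton.1 hw
    rw [smul_comm]
    refine N.smul_mem a ?_
    have h' : (s : R) • v = m := h
    rw [h']
    exact m.2
  | sup M₁ M₂ _ _ h₁ h₂ =>
    obtain ⟨r₁, hr₁, h₁⟩ := h₁
    obtain ⟨r₂, hr₂, h₂⟩ := h₂
    refine ⟨r₁ * r₂, mul_ne_zero hr₁ hr₂, fun v hv ↦ ?_⟩
    obtain ⟨a, ha, b, hb, rfl⟩ := Submodule.mem_sup.1 hv
    rw [smul_add]
    refine N.add_mem ?_ ?_
    · rw [mul_comm, mul_smul]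
      exact N.smul_mem _ (h₁ a ha)
    · rw [mul_smul]
      exact N.smul_mem _ (h₂ b hb)

lemma exists_pow_smul_mem_of_isLattice [IsDiscreteValuationRing R] {π : R} (hπ : Irreducible π)
    {M N : Submodule R V} (hM : M.FG) [Submodule.IsLattice A N] :
    ∃ n : ℕ, ∀ v ∈ M, π ^ n • v ∈ N := by
  obtain ⟨r, hr, h⟩ := exists_smul_mem_of_isLattice (A := A) (N := N) hM
  obtain ⟨n, u, hu⟩ := IsDiscreteValuationRing.associated_pow_irreducible hr hπ
  refine ⟨n, fun v hv ↦ ?_⟩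
  rw [← hu, mul_comm, mul_smul]
  exact N.smul_mem _ (h v hv)

namespace Submodule.IsLattice

variable [IsPrincipalIdealRing R]

lemma exists_basis_span_eq (M : Submodule R V) [Submodule.IsLattice A M] :
    ∃ (n : ℕ) (b : Module.Basis (Fin n) A V), M = span R (Set.range b) := by
  have : Module.Free R M := Submodule.IsLattice.free A M
  have : Module.Finite R M := Submodule.IsLattice.finite A M
  let b := Module.finBasis R M
  refine ⟨_, b.extendOfIsLattice A, ?_⟩
  have h : Set.range (b.extendOfIsLattice A) = M.subtype '' Set.range b := by
    rw [← Set.range_comp]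
    congr 1
    ext i
    simp
  rw [h, ← Submodule.map_span, b.span_eq, Submodule.map_subtype_top]

lemma dualSubmodule {B : BilinForm A V} (hB : B.Nondegenerate) (M : Submodule R V)
    [Submodule.IsLattice A M] : Submodule.IsLattice A (B.dualSubmodule M) := by
  classical
  obtain ⟨n, b, rfl⟩ := exists_basis_span_eq (A := A) M
  have := Module.Finite.of_basis b
  rw [B.dualSubmodule_span_of_basis hB]
  refine ⟨fg_span (Set.finite_range _), ?_⟩
  rw [span_span_of_tower, Module.Basis.span_eq]

lemma dualSubmodule_dualSubmodule_flip {B : BilinForm A V} (hB : B.Nondegenerate)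
    (M : Submodule R V) [Submodule.IsLattice A M] :
    B.dualSubmodule (B.flip.dualSubmodule M) = M := by
  obtain ⟨n, b, rfl⟩ := exists_basis_span_eq (A := A) M
  exact B.dualSubmodule_dualSubmodule_flip_of_basis hB b

end Submodule.IsLattice

/-- The pairing on a lattice that is equal to its own dual is perfect. -/
lemma exists_linearEquiv_dual_of_dualSubmodule_eq [FiniteDimensional A V] {B : BilinForm A V}
    (hB : B.Nondegenerate) (M : Submodule R V) [Submodule.IsLattice A M]
    (hM : B.dualSubmodule M = M) :
    ∃ e : M ≃ₗ[R] Module.Dual R M, ∀ v w : M, algebraMap R A (e v w) = B v w := by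
  have hbij : Function.Bijective (B.dualSubmoduleToDual M) := by
    refine ⟨B.dualSubmoduleToDual_injective hB M (Submodule.IsLattice.span_eq_top (A := A)),
      fun f ↦ ?_⟩
    obtain ⟨F, hF⟩ := exists_dual_extension_of_isLattice (A := A) M f
    have hz : ∀ m : M, B ((B.toDual hB).symm F) m = algebraMap R A (f m) := fun m ↦ by
      rw [BilinForm.apply_toDual_symm_apply, hF]
    refine ⟨⟨(B.toDual hB).symm F, fun m hm ↦ ?_⟩, ?_⟩
    · exact Submodule.mem_one.2 ⟨_, (hz ⟨m, hm⟩).symm⟩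
    · ext m
      apply FaithfulSMul.algebraMap_injective R A
      simp [hz]
  refine ⟨(LinearEquiv.ofEq M (B.dualSubmodule M) hM.symm).trans
    (LinearEquiv.ofBijective _ hbij), fun v w ↦ ?_⟩
  simp

end Lattices

/-! ### Modifying an invariant form -/

section Forms

variable {K G V : Type*} [Field K] [Group G] [AddCommGroup V] [Module K V] [FiniteDimensional K V]

/-- The involution `U` attached to an isometry `T` is `-1` on the generalized eigenspace of `T` for
`-1`, and `1` on its Fitting complement. It commutes with everything that commutes with `T`, and it
is self-adjoint because the two summands are orthogonal. On the first summand `1 + T * U` is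
`1 - T`, on the second it is `1 + T`. -/
lemma exists_involution_of_isometry [CharZero K] {B : BilinForm K V} {T : Module.End K V}
    (hTinj : Function.Injective T) (hT : ∀ v w, B (T v) (T w) = B v w) :
    ∃ U : Module.End K V, (∀ v, U (U v) = v) ∧ (∀ v w, B (U v) w = B v (U w)) ∧
      (∀ X : Module.End K V, (∀ v, X (T v) = T (X v)) → ∀ v, X (U v) = U (X v)) ∧
      Function.Injective (1 + T * U : Module.End K V) := by
  obtain ⟨n, hcompl, hn⟩ := ((LinearMap.eventually_isCompl_ker_pow_range_pow (1 + T)).and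
    (Filter.eventually_ge_atTop 1)).exists
  set N : Module.End K V := (1 + T) ^ n with hN
  let U : Module.End K V := LinearMap.ofIsCompl hcompl (-(LinearMap.ker N).subtype)
    (LinearMap.range N).subtype
  have hUk : ∀ v, N v = 0 → U v = -v := fun v hv ↦
    LinearMap.ofIsCompl_apply_left hcompl ⟨v, hv⟩
  have hUr : ∀ v, U (N v) = N v := fun v ↦
    LinearMap.ofIsCompl_apply_right hcompl ⟨N v, v, rfl⟩
  have hdec : ∀ v, ∃ k r, N k = 0 ∧ v = k + N r := fun v ↦ by
    obtain ⟨k, hk, _, ⟨r, rfl⟩, h⟩ := Submodule.mem_sup.1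
      (hcompl.sup_eq_top ▸ Submodule.mem_top : v ∈ LinearMap.ker N ⊔ LinearMap.range N)
    exact ⟨k, r, hk, h.symm⟩
  have hzero : ∀ r, N (N r) = 0 → N r = 0 := fun r h ↦
    (Submodule.disjoint_def.1 hcompl.disjoint) _ h ⟨r, rfl⟩
  have hXN : ∀ X : Module.End K V, (∀ v, X (T v) = T (X v)) → ∀ v, X (N v) = N (X v) := by
    intro X hX v
    have h : Commute X (1 + T) := by
      apply LinearMap.ext
      intro v
      simp [hX]
    exact LinearMap.congr_fun (h.pow_right n) v
  have hTN := hXN T fun _ ↦ rfl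
  -- the adjoint of `1 + T` is `T⁻¹ (1 + T)`, so that of `N` is `T⁻ⁿ N`
  have hadj : ∀ m v w, B (((1 + T) ^ m) v) ((T ^ m) w) = B v (((1 + T) ^ m) w) := by
    intro m
    induction m with
    | zero => intro v w; simp
    | succ m ih =>
      intro v w
      have hc : Commute T ((1 + T) ^ m) := by
        exact ((Commute.one_right T).add_right (Commute.refl T)).pow_right m
      have h1 : ((1 + T) ^ (m + 1)) v = ((1 + T) ^ m) (v + T v) := by
        simp [pow_succ]
      have h2 : (T ^ (m + 1)) w = (T ^ m) (T w) := by simp [pow_succ]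
      have h3 : ((1 + T) ^ (m + 1)) w = ((1 + T) ^ m) w + T (((1 + T) ^ m) w) := by
        rw [pow_succ']
        simp
      have h4 : ((1 + T) ^ m) (T w) = T (((1 + T) ^ m) w) := (LinearMap.congr_fun hc w).symm
      rw [h1, h2, ih, h3, h4, map_add, map_add, LinearMap.add_apply, hT, add_comm]
  have hTn : ∀ k, N k = 0 → ∃ k', N k' = 0 ∧ k = (T ^ n) k' := fun k hk ↦ by
    have hinj : Function.Injective (T ^ n) := by
      rw [Module.End.coe_pow]
      exact hTinj.iterate n
    obtain ⟨k', rfl⟩ := LinearMap.injective_iff_surjective.1 hinj k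
    refine ⟨k', hinj ?_, rfl⟩
    rw [map_zero, ← hk]
    exact LinearMap.congr_fun (((Commute.one_right T).add_right (Commute.refl T)).pow_pow n n) k'
  have horth₁ : ∀ k r, N k = 0 → B (N r) k = 0 := fun k r hk ↦ by
    obtain ⟨k', hk', rfl⟩ := hTn k hk
    rw [hadj n, hk', map_zero]
  have horth₂ : ∀ k r, N k = 0 → B k (N r) = 0 := fun k r hk ↦ by
    rw [← hadj n, hk, map_zero, LinearMap.zero_apply]
  have hUU : ∀ X : Module.End K V, (∀ v, X (T v) = T (X v)) → ∀ v, X (U v) = U (X v) := by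
    intro X hX v
    obtain ⟨k, r, hk, rfl⟩ := hdec v
    have hXk : N (X k) = 0 := by rw [← hXN X hX, hk, map_zero]
    simp only [map_add, hUk k hk, hUr, hXN X hX, hUk _ hXk, map_neg]
  refine ⟨U, fun v ↦ ?_, fun v w ↦ ?_, hUU, ?_⟩
  · obtain ⟨k, r, hk, rfl⟩ := hdec v
    simp only [map_add, hUk k hk, hUr, map_neg, neg_neg]
  · obtain ⟨k, r, hk, rfl⟩ := hdec v
    obtain ⟨k', r', hk', rfl⟩ := hdec w
    simp only [map_add, hUk k hk, hUk k' hk', hUr, map_neg, LinearMap.add_apply,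
      LinearMap.neg_apply, horth₁ _ _ hk', horth₂ _ _ hk]
    simp
  · rw [← LinearMap.ker_eq_bot, LinearMap.ker_eq_bot']
    intro v hv
    obtain ⟨k, r, hk, rfl⟩ := hdec v
    have hv' : k - T k + N (r + T r) = 0 := by
      simp only [LinearMap.add_apply, Module.End.one_apply, Module.End.mul_apply, map_add,
        hUk k hk, hUr, map_neg] at hv
      rw [map_add, ← hTN, ← hv]
      abel
    have hNk : N (k - T k) = 0 := by rw [map_sub, ← hTN, hk, map_zero, sub_zero]
    have hr : N (r + T r) = 0 := hzero _ (by
      rw [eq_neg_of_add_eq_zero_right hv', map_neg, hNk, neg_zero])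
    have hk0 : k - T k = 0 := by rwa [hr, add_zero] at hv'
    have hr0 : N r = 0 := by
      apply hzero
      obtain ⟨m, rfl⟩ := Nat.exists_eq_add_of_le' hn
      have h : N (N r) = ((1 + T) ^ m) ((1 + T) (N r)) := by
        rw [hN, pow_succ]
        rfl
      rw [h, LinearMap.add_apply, Module.End.one_apply, hTN, ← map_add, hr, map_zero]
    -- on the kernel `T` acts as `1`, hence `N` acts as `2 ^ n`
    have hpow : ∀ m, ((1 + T) ^ m) k = (2 ^ m : K) • k := by
      intro m
      induction m with
      | zero => simp
      | succ m ih =>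
        rw [pow_succ', Module.End.mul_apply, ih, map_smul, LinearMap.add_apply,
          Module.End.one_apply, ← sub_eq_zero.1 hk0, ← two_smul K k, smul_smul, pow_succ]
    have hk1 : k = 0 := by
      have h := hpow n
      rw [← hN, hk] at h
      exact (smul_eq_zero.1 h.symm).resolve_left (pow_ne_zero n two_ne_zero)
    rw [hk1, hr0, add_zero]

/-- An invariant form `B` can be chosen such that its twisted transpose `(v, w) ↦ B (ρ s w) v` is
`B (U v) w` for an involution `U` commuting with the representation. If the twisted transpose of
the given form is `B (T v) w`, the new form is `B ((1 + T * U) v) w`. -/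
lemma exists_form_of_isometry_twist [CharZero K] (ρ : Representation K G V) (θ : G →* G) (s : G)
    (hs : θ s = s) (hθ : ∀ g, θ (θ g) = s * g * s⁻¹) (B : BilinForm K V)
    (hB : B.Nondegenerate) (hinv : ∀ g v w, B (ρ (θ g) v) (ρ g w) = B v w) :
    ∃ (B' : BilinForm K V) (U : Module.End K V), B'.Nondegenerate ∧
      (∀ g v w, B' (ρ (θ g) v) (ρ g w) = B' v w) ∧ (∀ v, U (U v) = v) ∧
      (∀ g v, ρ g (U v) = U (ρ g v)) ∧ ∀ v w, B' (ρ s w) v = B' (U v) w := by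
  have hinvs : ∀ v w, B (ρ s v) (ρ s w) = B v w := fun v w ↦ by
    simpa [hs] using hinv s v w
  let C : BilinForm K V := (B.comp (ρ s) LinearMap.id).flip
  have hC : ∀ v w, C v w = B (ρ s w) v := fun v w ↦ rfl
  let T : Module.End K V := BilinForm.symmCompOfNondegenerate C B hB
  have hBT : ∀ v w, B (T v) w = B (ρ s w) v := fun v w ↦ by
    rw [← hC]
    exact BilinForm.symmCompOfNondegenerate_left_apply C hB w v
  have hsep : ∀ v v', (∀ w, B v w = B v' w) → v = v' := fun v v' h ↦
    LinearMap.ker_eq_bot.1 hB.ker_eq_bot (LinearMap.ext h)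
  have hθsurj : Function.Surjective θ := fun g ↦ ⟨θ (s⁻¹ * g * s), by rw [hθ]; group⟩
  have hρinv : ∀ g v, ρ g (ρ g⁻¹ v) = v := fun g v ↦ by
    rw [← Module.End.mul_apply, ← map_mul, mul_inv_cancel, map_one, Module.End.one_apply]
  have hTρ : ∀ g v, ρ g (T v) = T (ρ g v) := by
    intro g v
    obtain ⟨h, rfl⟩ := hθsurj g
    refine hsep _ _ fun w ↦ ?_
    rw [← hρinv h w, hinv, hBT, hBT]
    have h1 : ρ s (ρ h (ρ h⁻¹ w)) = ρ (θ (θ h)) (ρ s (ρ h⁻¹ w)) := by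
      rw [hθ]
      simp only [← Module.End.mul_apply, ← map_mul]
      congr 2
      group
    rw [h1, hinv]
  have hTT : ∀ v w, B (T v) (T w) = B v w := fun v w ↦ by
    rw [hBT, hTρ, hBT, hinvs]
  have hTinj : Function.Injective T := fun v w h ↦ hsep _ _ fun x ↦ by
    rw [← hTT v, ← hTT w, h]
  obtain ⟨U, hUU, hUadj, hUcomm, hinj⟩ := exists_involution_of_isometry hTinj hTT
  have hUρ : ∀ g v, ρ g (U v) = U (ρ g v) := fun g ↦ hUcomm (ρ g) (hTρ g)
  have hUT : ∀ v, T (U v) = U (T v) := hUcomm T fun _ ↦ rfl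
  have hB' : ∀ v w, B.comp (1 + T * U) LinearMap.id v w = B v w + B (T (U v)) w :=
    fun v w ↦ by simp
  refine ⟨B.comp (1 + T * U) LinearMap.id, U, ?_, fun g v w ↦ ?_, hUU, hUρ, fun v w ↦ ?_⟩
  · refine BilinForm.Nondegenerate.ofSeparatingLeft fun v hv ↦ hinj ?_
    rw [map_zero]
    refine hsep _ _ fun w ↦ ?_
    rw [map_zero]
    exact hv w
  · rw [hB', hB', ← hUρ, ← hTρ, hinv, hinv]
  · rw [hB', hB', hUU, hBT, hBT, ← hUρ, hinvs, hUadj, add_comm]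

end Forms

/-! ### The quadratic extension generated by a square root of a uniformizer -/

section Quadratic

open Polynomial

/-- There is no cancellation between `a ^ 2` and `π * b ^ 2`, as their valuations at `π` have
different parities. -/
lemma pow_dvd_of_pow_dvd_sq_sub_mul_sq {O : Type*} [CommRing O] [IsDomain O] {π : O}
    (hπ : Prime π) : ∀ (n : ℕ) {a b : O}, π ^ (2 * n) ∣ a ^ 2 - π * b ^ 2 → π ^ n ∣ a ∧ π ^ n ∣ b
  | 0, _, _, _ => by simp
  | n + 1, a, b, h => by
    obtain ⟨c, hc⟩ := h
    have ha : π ∣ a := hπ.dvd_of_dvd_pow (n := 2)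
      ⟨b ^ 2 + π ^ (2 * n + 1) * c, by linear_combination hc⟩
    obtain ⟨a, rfl⟩ := ha
    have hb : π ∣ b := hπ.dvd_of_dvd_pow (n := 2)
      ⟨a ^ 2 - π ^ (2 * n) * c, mul_left_cancel₀ hπ.ne_zero (by linear_combination -hc)⟩
    obtain ⟨b, rfl⟩ := hb
    have h' := pow_dvd_of_pow_dvd_sq_sub_mul_sq hπ n (a := a) (b := b)
      ⟨c, mul_left_cancel₀ (pow_ne_zero 2 hπ.ne_zero) (by linear_combination hc)⟩
    rw [pow_succ']
    exact ⟨mul_dvd_mul_left π h'.1, mul_dvd_mul_left π h'.2⟩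

variable {O K K' : Type*} [CommRing O] [IsDomain O] [IsDiscreteValuationRing O] [Field K]
  [Algebra O K] [IsFractionRing O K] [Field K'] [Algebra K K'] [Algebra O K'] [IsScalarTower O K K']

lemma mem_range_of_sq_sub_mul_sq_mem_range {π : O} (hπ : Irreducible π) {a b : K}
    (h : a ^ 2 - algebraMap O K π * b ^ 2 ∈ (algebraMap O K).range) :
    a ∈ (algebraMap O K).range ∧ b ∈ (algebraMap O K).range := by
  classical
  obtain ⟨c, hc⟩ := h
  have hinj := FaithfulSMul.algebraMap_injective O K
  obtain ⟨n, α, β, hα, hβ⟩ : ∃ (n : ℕ) (α β : O), algebraMap O K α = algebraMap O K π ^ n * a ∧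
      algebraMap O K β = algebraMap O K π ^ n * b := by
    obtain ⟨⟨d, hd⟩, hab⟩ := IsLocalization.exist_integer_multiples_of_finset
      (nonZeroDivisors O) ({a, b} : Finset K)
    obtain ⟨n, u, hu⟩ := IsDiscreteValuationRing.associated_pow_irreducible
      (nonZeroDivisors.ne_zero hd) hπ
    obtain ⟨α, hα⟩ := hab a (by simp)
    obtain ⟨β, hβ⟩ := hab b (by simp)
    simp only [Algebra.smul_def] at hα hβ
    refine ⟨n, u * α, u * β, ?_, ?_⟩
    · rw [map_mul, hα, ← map_pow, ← hu, map_mul]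
      ring
    · rw [map_mul, hβ, ← map_pow, ← hu, map_mul]
      ring
  have hπ0 : algebraMap O K π ^ n ≠ 0 := pow_ne_zero n (by simpa using hπ.ne_zero)
  obtain ⟨⟨γ, rfl⟩, ⟨δ, rfl⟩⟩ := pow_dvd_of_pow_dvd_sq_sub_mul_sq hπ.prime n (a := α) (b := β)
    ⟨c, hinj (by
      simp only [map_sub, map_mul, map_pow, hα, hβ, hc]
      ring)⟩
  rw [map_mul, map_pow] at hα hβ
  exact ⟨⟨γ, mul_left_cancel₀ hπ0 hα⟩, ⟨δ, mul_left_cancel₀ hπ0 hβ⟩⟩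

variable {π : O} {x : K'}

lemma algebraMap_ne_of_sq_eq (hπ : Irreducible π) (hx : x ^ 2 = algebraMap O K' π) (a : K) :
    algebraMap K K' a ≠ x := by
  rintro rfl
  rw [IsScalarTower.algebraMap_apply O K K', ← map_pow] at hx
  have ha : a ^ 2 = algebraMap O K π := (algebraMap K K').injective hx
  obtain ⟨c, rfl⟩ := IsIntegrallyClosed.exists_algebraMap_eq_of_isIntegral_pow (R := O)
    two_pos (x := a) (ha ▸ isIntegral_algebraMap)
  rw [← map_pow] at ha
  have hc := FaithfulSMul.algebraMap_injective O K ha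
  exact hπ.not_isSquare ⟨c, by rw [← hc, sq]⟩

lemma eq_zero_of_add_mul_eq_zero (hπ : Irreducible π) (hx : x ^ 2 = algebraMap O K' π) {a b : K}
    (h : algebraMap K K' a + algebraMap K K' b * x = 0) : a = 0 ∧ b = 0 := by
  have hb : b = 0 := by
    by_contra hb
    refine algebraMap_ne_of_sq_eq hπ hx (-a / b) ?_
    have hb' : algebraMap K K' b ≠ 0 := by simpa using hb
    rw [map_div₀, map_neg, div_eq_iff hb']
    linear_combination -h
  subst hb
  simpa using h

/-- The integers of `K(√π)` are `O ⊕ O √π`: the norm `a ^ 2 - π b ^ 2` of an integer is in `O`, and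
its two terms have valuations of different parity. -/
lemma isIntegral_add_mul_iff (hπ : Irreducible π) (hx : x ^ 2 = algebraMap O K' π) {a b : K} :
    IsIntegral O (algebraMap K K' a + algebraMap K K' b * x) ↔
      a ∈ (algebraMap O K).range ∧ b ∈ (algebraMap O K).range := by
  constructor
  · intro h
    by_cases hb : b = 0
    · subst hb
      rw [map_zero, zero_mul, add_zero, isIntegral_algebraMap_iff (algebraMap K K').injective] at h
      exact ⟨IsIntegrallyClosed.isIntegral_iff.1 h, 0, map_zero _⟩
    set y := algebraMap K K' a + algebraMap K K' b * x with hy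
    have hyr : y ∉ (algebraMap K K').range := by
      rintro ⟨c, hc⟩
      exact hb (eq_zero_of_add_mul_eq_zero hπ hx (a := a - c) (b := b) (by
        rw [map_sub]; linear_combination -hc - hy)).2
    let q : K[X] := X ^ 2 + (C (-2 * a) * X + C (a ^ 2 - algebraMap O K π * b ^ 2))
    have hqdeg : (C (-2 * a) * X + C (a ^ 2 - algebraMap O K π * b ^ 2)).degree < 2 :=
      degree_linear_lt
    have hq : q.Monic := monic_X_pow_add hqdeg
    have hqnat : q.natDegree = 2 := by
      simp only [q]
      compute_degree!
    have hint : IsIntegral K y := h.tower_top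
    have hdvd : minpoly K y ∣ q := minpoly.dvd K y (by
      simp only [q, map_add, map_mul, map_sub, map_pow, aeval_X, aeval_C, map_neg, map_ofNat,
        ← IsScalarTower.algebraMap_apply O K K']
      rw [hy]
      linear_combination (algebraMap K K' b) ^ 2 * hx)
    -- `b ≠ 0`, so the minimal polynomial has degree two and its constant term is the norm
    have hmin : q = minpoly K y := (eq_of_monic_of_dvd_of_natDegree_le (minpoly.monic hint) hq hdvd
      (by rw [hqnat]; exact (minpoly.two_le_natDegree_iff hint).2 hyr))
    refine mem_range_of_sq_sub_mul_sq_mem_range hπ ⟨(minpoly O y).coeff 0, ?_⟩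
    rw [← coeff_map, ← minpoly.isIntegrallyClosed_eq_field_fractions' K h, ← hmin]
    simp [q, coeff_zero_eq_eval_zero]
  · rintro ⟨⟨a, rfl⟩, ⟨b, rfl⟩⟩
    have hxint : IsIntegral O x := IsIntegral.of_pow two_pos (hx ▸ isIntegral_algebraMap)
    simp only [← IsScalarTower.algebraMap_apply O K K']
    exact isIntegral_algebraMap.add (isIntegral_algebraMap.mul hxint)

/-- The maximal ideal of the ring of integers is generated by `x = √π`. -/
lemma isTotallyRamifiedExt_of_sq_eq (hπ : Irreducible π) (hx : x ^ 2 = algebraMap O K' π)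
    (hspan : ∀ y : K', ∃ a b : K, y = algebraMap K K' a + algebraMap K K' b * x)
    (hrank : Module.finrank K K' = 2) : IsTotallyRamifiedExt O K K' := by
  have hxint : IsIntegral O x := IsIntegral.of_pow two_pos (hx ▸ isIntegral_algebraMap)
  let X : integralClosure O K' := ⟨x, hxint⟩
  have hX : X ^ 2 = algebraMap O _ π := Subtype.ext hx
  refine ⟨Module.finite_of_finrank_pos (by omega), Ideal.span {X}, ?_, ?_⟩
  · refine Ideal.isMaximal_iff.2 ⟨fun h1 ↦ ?_, fun J y hJ hy hyJ ↦ ?_⟩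
    · obtain ⟨y, hy⟩ := Ideal.mem_span_singleton'.1 h1
      obtain ⟨a, b, hab⟩ := hspan y
      have hint := y.2
      rw [hab, mem_integralClosure_iff, isIntegral_add_mul_iff hπ hx] at hint
      obtain ⟨-, ⟨β, rfl⟩⟩ := hint
      have h := congrArg Subtype.val hy
      change (y : K') * x = 1 at h
      rw [hab] at h
      have h0 := (eq_zero_of_add_mul_eq_zero hπ hx
        (a := algebraMap O K π * algebraMap O K β - 1) (b := a) (by
          rw [map_sub, map_mul, map_one, ← IsScalarTower.algebraMap_apply O K K', ← hx]
          linear_combination h)).1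
      rw [← map_mul, sub_eq_zero, ← map_one (algebraMap O K)] at h0
      exact hπ.not_isUnit (IsUnit.of_mul_eq_one _ (FaithfulSMul.algebraMap_injective O K h0))
    · obtain ⟨a, b, hab⟩ := hspan y
      have hint := y.2
      rw [hab, mem_integralClosure_iff, isIntegral_add_mul_iff hπ hx] at hint
      obtain ⟨⟨α, rfl⟩, ⟨β, rfl⟩⟩ := hint
      have hy' : y = algebraMap O _ α + algebraMap O _ β * X := Subtype.ext (by
        rw [hab, ← IsScalarTower.algebraMap_apply, ← IsScalarTower.algebraMap_apply]
        rfl)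
      have hXJ : X ∈ J := hJ (Ideal.mem_span_singleton_self X)
      have hα : IsUnit α := by
        by_contra hα
        obtain ⟨δ, rfl⟩ := (IsDiscreteValuationRing.irreducible_iff_uniformizer π).1 hπ ▸
          (IsLocalRing.mem_maximalIdeal α).2 hα |> Ideal.mem_span_singleton.1
        refine hy (hy' ▸ Ideal.mem_span_singleton'.2 ⟨X * algebraMap O _ δ + algebraMap O _ β, ?_⟩)
        rw [map_mul, ← hX]
        ring
      have hαJ : algebraMap O (integralClosure O K') α ∈ J := by
        have := J.sub_mem hyJ (J.mul_mem_left (algebraMap O _ β) hXJ)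
        rwa [hy', add_sub_cancel_right] at this
      exact (Ideal.eq_top_iff_one J).1 (J.eq_top_of_isUnit_mem hαJ (hα.map _))
  · rw [hrank, Ideal.span_singleton_pow, hX,
      (IsDiscreteValuationRing.irreducible_iff_uniformizer π).1 hπ, Ideal.map_span,
      Set.image_singleton]

lemma exists_intermediateField_sqrt (hπ : Irreducible π) (Ω : Type*) [Field Ω] [Algebra K Ω]
    [Algebra O Ω] [IsScalarTower O K Ω] [IsAlgClosed Ω] :
    ∃ (L : IntermediateField K Ω) (x : L), x ^ 2 = algebraMap O L π ∧ Module.finrank K L = 2 ∧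
      ∀ y : L, ∃ a b : K, y = algebraMap K L a + algebraMap K L b * x := by
  obtain ⟨x, hx⟩ := IsAlgClosed.exists_pow_nat_eq (algebraMap O Ω π) two_pos
  have hroot : aeval x (X ^ 2 - C (algebraMap O K π)) = 0 := by
    simp [hx, ← IsScalarTower.algebraMap_apply]
  have hmonic : (X ^ 2 - C (algebraMap O K π)).Monic := monic_X_pow_sub_C _ two_ne_zero
  have hint : IsIntegral K x := ⟨_, hmonic, hroot⟩
  have hdeg : (minpoly K x).natDegree = 2 := by
    refine le_antisymm ?_ ((minpoly.two_le_natDegree_iff hint).2 ?_)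
    · rw [← natDegree_X_pow_sub_C (n := 2) (r := algebraMap O K π)]
      exact natDegree_le_of_dvd (minpoly.dvd K x hroot) hmonic.ne_zero
    · rintro ⟨a, ha⟩
      exact algebraMap_ne_of_sq_eq hπ hx a ha
  have hrank : Module.finrank K (IntermediateField.adjoin K {x}) = 2 := by
    rw [IntermediateField.adjoin.finrank hint, hdeg]
  let x' : IntermediateField.adjoin K {x} := IntermediateField.AdjoinSimple.gen K x
  have hx' : x' ^ 2 = algebraMap O _ π := Subtype.ext hx
  refine ⟨IntermediateField.adjoin K {x}, x', hx', hrank, fun y ↦ ?_⟩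
  have hli : LinearIndependent K ![1, x'] := LinearIndependent.pair_iff.2 fun a b h ↦
    eq_zero_of_add_mul_eq_zero hπ hx' (by simpa [Algebra.smul_def] using h)
  have htop := hli.span_eq_top_of_card_eq_finrank (by simp [hrank])
  have hy : y ∈ Submodule.span K (Set.range ![1, x']) := htop ▸ Submodule.mem_top
  rw [Matrix.range_cons_cons_empty, Submodule.mem_span_pair] at hy
  obtain ⟨a, b, rfl⟩ := hy
  exact ⟨a, b, by simp [Algebra.smul_def]⟩

end Quadratic

/-! ### Lattices between their dual and a multiple of it -/

section NearlySelfDual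

variable {O K V : Type*} [CommRing O] [IsDomain O] [IsDiscreteValuationRing O] [Field K]
  [Algebra O K] [IsFractionRing O K] [AddCommGroup V] [Module K V] [Module O V]
  [IsScalarTower O K V] [FiniteDimensional K V]

/-- Let duality preserve the lattices stable under a set `S` of endomorphisms, the left and right
duals being equal. If there is such a lattice at all, one of them lies between its dual and `π`
times its dual. -/
lemma exists_lattice_le_dual_of_stable {π : O} (hπ : Irreducible π) {B : BilinForm K V}
    (hB : B.Nondegenerate) (S : Set (Module.End K V))
    (hS : ∀ Λ : Submodule O V, Submodule.IsLattice K Λ → (∀ X ∈ S, ∀ v ∈ Λ, X v ∈ Λ) →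
      (∀ X ∈ S, ∀ v ∈ B.dualSubmodule Λ, X v ∈ B.dualSubmodule Λ) ∧
        B.flip.dualSubmodule Λ = B.dualSubmodule Λ)
    (Λ₀ : Submodule O V) [Submodule.IsLattice K Λ₀] (hΛ₀ : ∀ X ∈ S, ∀ v ∈ Λ₀, X v ∈ Λ₀) :
    ∃ Λ : Submodule O V, Submodule.IsLattice K Λ ∧ (∀ X ∈ S, ∀ v ∈ Λ, X v ∈ Λ) ∧
      Λ ≤ B.dualSubmodule Λ ∧ ∀ v ∈ B.dualSubmodule Λ, π • v ∈ Λ := by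
  have hanti : ∀ M N : Submodule O V, M ≤ N → B.dualSubmodule N ≤ B.dualSubmodule M :=
    fun M N h v hv w hw ↦ hv w (h hw)
  obtain ⟨n, Λ, hΛ, hst, hle, hn⟩ : ∃ (n : ℕ) (Λ : Submodule O V), Submodule.IsLattice K Λ ∧
      (∀ X ∈ S, ∀ v ∈ Λ, X v ∈ Λ) ∧ Λ ≤ B.dualSubmodule Λ ∧
      ∀ v ∈ B.dualSubmodule Λ, π ^ n • v ∈ Λ := by
    have h0 : Submodule.IsLattice K (B.dualSubmodule Λ₀) := .dualSubmodule hB Λ₀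
    have h1 : Submodule.IsLattice K (Λ₀ ⊓ B.dualSubmodule Λ₀) := .inf K _ _
    have h2 : Submodule.IsLattice K (B.dualSubmodule (Λ₀ ⊓ B.dualSubmodule Λ₀)) :=
      .dualSubmodule hB _
    -- a lattice intersected with its dual is integral
    obtain ⟨n, hn⟩ := exists_pow_smul_mem_of_isLattice (A := K) hπ
      (N := Λ₀ ⊓ B.dualSubmodule Λ₀) h2.fg
    exact ⟨n, _, h1, fun X hX v hv ↦ ⟨hΛ₀ X hX v hv.1, (hS Λ₀ ‹_› hΛ₀).1 X hX v hv.2⟩,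
      inf_le_right.trans (hanti _ _ inf_le_left), hn⟩
  induction n using Nat.strong_induction_on generalizing Λ with
  | _ n ih =>
    match n, ih, hn with
    | 0, _, hn => exact ⟨Λ, hΛ, hst, hle, fun v hv ↦ Λ.smul_mem π (by simpa using hn v hv)⟩
    | 1, _, hn => exact ⟨Λ, hΛ, hst, hle, by simpa using hn⟩
    | m + 2, ih, hn =>
      obtain ⟨hdst, hflip⟩ := hS Λ hΛ hst
      have hd : Submodule.IsLattice K (B.dualSubmodule Λ) := .dualSubmodule hB Λ
      let Λ' := Λ ⊔ (B.dualSubmodule Λ).map (LinearMap.lsmul O V (π ^ (m + 1)))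
      have hmem : ∀ {v}, v ∈ Λ' ↔ ∃ a ∈ Λ, ∃ b ∈ B.dualSubmodule Λ, v = a + π ^ (m + 1) • b := by
        exact fun {v} ↦ ⟨fun h ↦ by
          obtain ⟨a, ha, _, ⟨b, hb, rfl⟩, rfl⟩ := Submodule.mem_sup.1 h
          exact ⟨a, ha, b, hb, rfl⟩, fun ⟨a, ha, b, hb, h⟩ ↦
            h ▸ Submodule.add_mem_sup ha (Submodule.mem_map_of_mem hb)⟩
      refine ih (m + 1) (by omega) Λ' ?_ ?_ ?_ ?_
      · exact .of_le_of_isLattice_of_fg K le_sup_left (hΛ.fg.sup (hd.fg.map _))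
      · intro X hX v hv
        obtain ⟨a, ha, b, hb, rfl⟩ := hmem.1 hv
        exact hmem.2 ⟨X a, hst X hX a ha, X b, hdst X hX b hb, by
          rw [map_add, LinearMap.map_smul_of_tower]⟩
      · intro v hv w hw
        obtain ⟨a, ha, b, hb, rfl⟩ := hmem.1 hv
        obtain ⟨a', ha', b', hb', rfl⟩ := hmem.1 hw
        have hr : ∀ u ∈ Λ, ∀ u' ∈ B.dualSubmodule Λ, B u u' ∈ (1 : Submodule O K) :=
          fun u hu u' hu' ↦ (hflip ▸ hu' : u' ∈ B.flip.dualSubmodule Λ) u hu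
        simp only [map_add, LinearMap.add_apply, LinearMap.map_smul_of_tower,
          LinearMap.smul_apply]
        -- of the `2 * (m + 1)` factors `π`, already `m + 2` bring `b` into `Λ`
        have hbb : π ^ (m + 1) • π ^ (m + 1) • B b b' = π ^ m • B (π ^ (m + 2) • b) b' := by
          rw [LinearMap.map_smul_of_tower, LinearMap.smul_apply, smul_smul, smul_smul, ← pow_add,
            ← pow_add]
          congr 2
          ring
        rw [hbb]
        exact add_mem (add_mem (hle ha a' ha') (Submodule.smul_mem _ _ (hb a' ha')))
          (add_mem (Submodule.smul_mem _ _ (hr a ha b' hb'))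
            (Submodule.smul_mem _ _ (hr _ (hn b hb) b' hb')))
      · intro v hv
        exact hmem.2 ⟨0, Λ.zero_mem, v, hanti _ _ le_sup_left hv, by rw [zero_add]⟩

/-- A representation that is conjugate self-dual over `K` has, for a suitable invariant form, a
stable lattice between its dual and `π` times its dual, with reflexive duality. -/
lemma exists_stable_lattice_le_dual {G : Type*} [Group G] {π : O} (hπ : Irreducible π)
    [CharZero K] (ρ : Representation K G V) (θ : G →* G) (s : G)
    (hs : θ s = s) (hθ : ∀ g, θ (θ g) = s * g * s⁻¹) {B : BilinForm K V}
    (hB : B.Nondegenerate) (hinv : ∀ g v w, B (ρ (θ g) v) (ρ g w) = B v w)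
    (Λ₀ : Submodule O V) [Submodule.IsLattice K Λ₀] (hΛ₀ : IsStableUnder ρ Λ₀) :
    ∃ (B' : BilinForm K V) (Λ : Submodule O V), B'.Nondegenerate ∧
      (∀ g v w, B' (ρ (θ g) v) (ρ g w) = B' v w) ∧ Submodule.IsLattice K Λ ∧
      IsStableUnder ρ Λ ∧ IsStableUnder ρ (B'.dualSubmodule Λ) ∧ Λ ≤ B'.dualSubmodule Λ ∧
      (∀ v ∈ B'.dualSubmodule Λ, π • v ∈ Λ) ∧
      B'.dualSubmodule (B'.dualSubmodule Λ) = Λ := by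
  obtain ⟨B', U, hB', hinv', hUU, hρU, hsU⟩ := exists_form_of_isometry_twist ρ θ s hs hθ B hB hinv
  have hρinv : ∀ g v, ρ g (ρ g⁻¹ v) = v := fun g v ↦ by
    rw [← Module.End.mul_apply, ← map_mul, mul_inv_cancel, map_one, Module.End.one_apply]
  have hθsurj : Function.Surjective θ := fun g ↦ ⟨θ (s⁻¹ * g * s), by rw [hθ]; group⟩
  have hUadj : ∀ v w, B' (U v) w = B' v (U w) := fun v w ↦ by
    have h1 : ∀ u, B' (U v) (U u) = B' v u := fun u ↦ by
      have h2 := hinv' s v u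
      rw [hs, hsU] at h2
      rw [← h2, ← hsU, hρU]
    rw [← h1, hUU]
  let S : Set (Module.End K V) := insert U (Set.range ρ)
  have hstable : ∀ Λ : Submodule O V, (∀ X ∈ S, ∀ v ∈ Λ, X v ∈ Λ) ↔
      IsStableUnder ρ Λ ∧ ∀ v ∈ Λ, U v ∈ Λ := fun Λ ↦ by
    simp only [S, Set.forall_mem_insert, Set.forall_mem_range, IsStableUnder]
    exact and_comm
  have hS : ∀ Λ : Submodule O V, Submodule.IsLattice K Λ → (∀ X ∈ S, ∀ v ∈ Λ, X v ∈ Λ) →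
      (∀ X ∈ S, ∀ v ∈ B'.dualSubmodule Λ, X v ∈ B'.dualSubmodule Λ) ∧
        B'.flip.dualSubmodule Λ = B'.dualSubmodule Λ := by
    intro Λ _ hst
    obtain ⟨hρ, hU⟩ := (hstable Λ).1 hst
    have hUd : ∀ v ∈ B'.dualSubmodule Λ, U v ∈ B'.dualSubmodule Λ := fun v hv w hw ↦ by
      rw [hUadj]
      exact hv _ (hU w hw)
    refine ⟨(hstable _).2 ⟨fun g v hv w hw ↦ ?_, hUd⟩, le_antisymm (fun v hv ↦ ?_) fun v hv w hw ↦ ?_⟩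
    · obtain ⟨h, rfl⟩ := hθsurj g
      rw [← hρinv h w, hinv']
      exact hv _ (hρ _ w hw)
    · rw [← hUU v]
      refine hUd _ fun w hw ↦ ?_
      rw [← hsU]
      exact hv _ (hρ s w hw)
    · change B' w v ∈ _
      rw [← hρinv s w, hsU]
      exact hUd v hv _ (hρ _ w hw)
  -- make the given lattice stable under `U`
  let Λ₁ : Submodule O V := Λ₀ ⊔ Λ₀.map (U.restrictScalars O)
  have hmem : ∀ {v}, v ∈ Λ₁ ↔ ∃ a ∈ Λ₀, ∃ b ∈ Λ₀, v = a + U b := by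
    exact fun {v} ↦ ⟨fun h ↦ by
      obtain ⟨a, ha, _, ⟨b, hb, rfl⟩, rfl⟩ := Submodule.mem_sup.1 h
      exact ⟨a, ha, b, hb, rfl⟩, fun ⟨a, ha, b, hb, h⟩ ↦
        h ▸ Submodule.add_mem_sup ha (Submodule.mem_map_of_mem hb)⟩
  have hΛ₁ : Submodule.IsLattice K Λ₁ := by
    have h0 : Submodule.IsLattice K Λ₀ := inferInstance
    exact .of_le_of_isLattice_of_fg K le_sup_left (h0.fg.sup (h0.fg.map _))
  obtain ⟨Λ, hΛ, hst, hle, hπΛ⟩ := exists_lattice_le_dual_of_stable hπ hB' S hS Λ₁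
    ((hstable _).2 ⟨fun g v hv ↦ by
      obtain ⟨a, ha, b, hb, rfl⟩ := hmem.1 hv
      exact hmem.2 ⟨_, hΛ₀ g a ha, _, hΛ₀ g b hb, by rw [map_add, hρU]⟩, fun v hv ↦ by
      obtain ⟨a, ha, b, hb, rfl⟩ := hmem.1 hv
      exact hmem.2 ⟨_, hb, _, ha, by rw [map_add, hUU, add_comm]⟩⟩)
  refine ⟨B', Λ, hB', hinv', hΛ, ((hstable _).1 hst).1, ((hstable _).1 (hS Λ hΛ hst).1).1, hle,
    hπΛ, ?_⟩
  rw [← (hS Λ hΛ hst).2]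
  exact Submodule.IsLattice.dualSubmodule_dualSubmodule_flip hB' Λ

end NearlySelfDual

/-! ### The self-dual lattice over the ramified extension -/

section RamifiedBaseChange

variable {O K K' V : Type*} [CommRing O] [Field K] [Field K'] [Algebra K K'] [Algebra O K']
  [AddCommGroup V] [Module K V]

lemma exists_tmul_add_tmul {x : K'}
    (hspan : ∀ y : K', ∃ a b : K, y = algebraMap K K' a + algebraMap K K' b * x)
    (z : K' ⊗[K] V) : ∃ v w : V, z = 1 ⊗ₜ v + x ⊗ₜ w := by
  induction z using TensorProduct.induction_on with
  | zero => exact ⟨0, 0, by simp⟩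
  | tmul y v =>
    obtain ⟨a, b, rfl⟩ := hspan y
    refine ⟨a • v, b • v, ?_⟩
    rw [TensorProduct.add_tmul, ← TensorProduct.smul_tmul, ← TensorProduct.smul_tmul,
      Algebra.algebraMap_eq_smul_one, Algebra.smul_def b x]
  | add z₁ z₂ h₁ h₂ =>
    obtain ⟨v₁, w₁, rfl⟩ := h₁
    obtain ⟨v₂, w₂, rfl⟩ := h₂
    exact ⟨v₁ + v₂, w₁ + w₂, by rw [TensorProduct.tmul_add, TensorProduct.tmul_add]; abel⟩

lemma mem_one_integralClosure {y : K'} :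
    y ∈ (1 : Submodule (integralClosure O K') K') ↔ IsIntegral O y := by
  rw [Submodule.mem_one]
  exact ⟨fun ⟨a, ha⟩ ↦ ha ▸ a.2, fun h ↦ ⟨⟨y, h⟩, rfl⟩⟩

lemma baseChange_nondegenerate_of_sq_eq [IsDomain O] [IsDiscreteValuationRing O] [Algebra O K]
    [IsFractionRing O K] [IsScalarTower O K K'] [FiniteDimensional K V] {π : O} {x : K'}
    (hπ : Irreducible π) (hx : x ^ 2 = algebraMap O K' π)
    (hspan : ∀ y : K', ∃ a b : K, y = algebraMap K K' a + algebraMap K K' b * x)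
    {B : BilinForm K V} (hB : B.Nondegenerate) : (B.baseChange K').Nondegenerate := by
  refine BilinForm.Nondegenerate.ofSeparatingLeft fun z hz ↦ ?_
  obtain ⟨v, w, rfl⟩ := exists_tmul_add_tmul hspan z
  have h : ∀ u, B v u = 0 ∧ B w u = 0 := fun u ↦ by
    have hu := hz (1 ⊗ₜ u)
    simp only [map_add, LinearMap.add_apply, BilinForm.baseChange_tmul, mul_one,
      Algebra.smul_def] at hu
    exact eq_zero_of_add_mul_eq_zero hπ hx hu
  rw [hB.1 v fun u ↦ (h u).1, hB.1 w fun u ↦ (h u).2, TensorProduct.tmul_zero,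
    TensorProduct.tmul_zero, add_zero]

variable [Module O V]

variable (K K') in
/-- The submodule of `K' ⊗ V` generated by `1 ⊗ Λ` and `x ⊗ D` over the integral closure of `O` in
`K'`. For `x ^ 2 = π` and `π D ≤ Λ ≤ D` it lies halfway between the extensions of scalars of `Λ`
and of `D`. -/
def ramifiedMidpoint (x : K') (Λ D : Submodule O V) :
    Submodule (integralClosure O K') (K' ⊗[K] V) :=
  Submodule.span _ ((fun v ↦ (1 : K') ⊗ₜ[K] v) '' Λ ∪ (fun v ↦ x ⊗ₜ[K] v) '' D)

variable {x : K'} {Λ D : Submodule O V}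

lemma one_tmul_mem_ramifiedMidpoint {v : V} (hv : v ∈ Λ) :
    (1 : K') ⊗ₜ[K] v ∈ ramifiedMidpoint K K' x Λ D :=
  Submodule.subset_span (Or.inl ⟨v, hv, rfl⟩)

lemma tmul_mem_ramifiedMidpoint {v : V} (hv : v ∈ D) :
    x ⊗ₜ[K] v ∈ ramifiedMidpoint K K' x Λ D :=
  Submodule.subset_span (Or.inr ⟨v, hv, rfl⟩)

variable [Algebra O K] [IsScalarTower O K V]

lemma isStableUnder_ramifiedMidpoint {G : Type*} [Group G] {ρ : Representation K G V}
    (hΛ : IsStableUnder ρ Λ) (hD : IsStableUnder ρ D) :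
    IsStableUnder (baseChangeRep K' ρ) (ramifiedMidpoint K K' x Λ D) := by
  intro g z hz
  induction hz using Submodule.span_induction with
  | mem z hz =>
    rcases hz with ⟨v, hv, rfl⟩ | ⟨v, hv, rfl⟩
    · exact one_tmul_mem_ramifiedMidpoint (hΛ g v hv)
    · exact tmul_mem_ramifiedMidpoint (hD g v hv)
  | zero => rw [map_zero]; exact zero_mem _
  | add z w _ _ hz hw => rw [map_add]; exact add_mem hz hw
  | smul a z _ hz =>
    rw [LinearMap.map_smul_of_tower]
    exact Submodule.smul_mem _ a hz

variable [IsScalarTower O K K']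

lemma isLattice_ramifiedMidpoint [hΛ : Submodule.IsLattice K Λ] (hD : D.FG) :
    Submodule.IsLattice K' (ramifiedMidpoint K K' x Λ D) := by
  let f (y : K') : V →ₗ[O] K' ⊗[K] V := (TensorProduct.mk K K' V y).restrictScalars O
  have heq : ramifiedMidpoint K K' x Λ D =
      Submodule.span (integralClosure O K')
        ((Λ.map (f 1) ⊔ D.map (f x) : Submodule O (K' ⊗[K] V)) : Set (K' ⊗[K] V)) := by
    have hsup : Λ.map (f 1) ⊔ D.map (f x) = Submodule.span O
        ((Λ.map (f 1) : Set (K' ⊗[K] V)) ∪ (D.map (f x) : Set (K' ⊗[K] V))) := by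
      rw [Submodule.span_union, Submodule.span_eq, Submodule.span_eq]
    rw [hsup, Submodule.span_span_of_tower]
    rfl
  constructor
  · obtain ⟨s, hs⟩ := (hΛ.fg.map (f 1)).sup (hD.map (f x))
    rw [heq, ← hs, Submodule.span_span_of_tower]
    exact ⟨s, rfl⟩
  · rw [eq_top_iff]
    have h1 : ∀ v : V, (1 : K') ⊗ₜ[K] v ∈
        Submodule.span K' (ramifiedMidpoint K K' x Λ D : Set (K' ⊗[K] V)) := by
      intro v
      have hv : v ∈ Submodule.span K (Λ : Set V) := hΛ.span_eq_top ▸ Submodule.mem_top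
      induction hv using Submodule.span_induction with
      | mem v hv => exact Submodule.subset_span (one_tmul_mem_ramifiedMidpoint hv)
      | zero => rw [TensorProduct.tmul_zero]; exact zero_mem _
      | add v w _ _ hv hw => rw [TensorProduct.tmul_add]; exact add_mem hv hw
      | smul a v _ hv =>
        rw [← TensorProduct.smul_tmul, ← algebraMap_smul K' a, ← TensorProduct.smul_tmul']
        exact Submodule.smul_mem _ _ hv
    rintro z -
    induction z using TensorProduct.induction_on with
    | zero => exact zero_mem _
    | tmul y v =>
      rw [← mul_one y, ← smul_eq_mul, ← TensorProduct.smul_tmul']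
      exact Submodule.smul_mem _ _ (h1 v)
    | add z₁ z₂ h₁ h₂ => exact add_mem h₁ h₂

variable [IsDomain O] [IsDiscreteValuationRing O] [IsFractionRing O K] {π : O}

lemma dualSubmodule_ramifiedMidpoint (hπ : Irreducible π) (hx : x ^ 2 = algebraMap O K' π)
    (hspan : ∀ y : K', ∃ a b : K, y = algebraMap K K' a + algebraMap K K' b * x)
    {B : BilinForm K V} {Λ : Submodule O V} (hle : Λ ≤ B.dualSubmodule Λ)
    (hπΛ : ∀ v ∈ B.dualSubmodule Λ, π • v ∈ Λ)
    (hdd : B.dualSubmodule (B.dualSubmodule Λ) = Λ) :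
    (B.baseChange K').dualSubmodule (ramifiedMidpoint K K' x Λ (B.dualSubmodule Λ)) =
      ramifiedMidpoint K K' x Λ (B.dualSubmodule Λ) := by
  have hint : ∀ a b : K, a ∈ (1 : Submodule O K) → b ∈ (1 : Submodule O K) →
      algebraMap K K' a + algebraMap K K' b * x ∈ (1 : Submodule (integralClosure O K') K') :=
    fun a b ha hb ↦ mem_one_integralClosure.2 ((isIntegral_add_mul_iff hπ hx).2
      ⟨Submodule.mem_one.1 ha, Submodule.mem_one.1 hb⟩)
  have hint' : ∀ a b : K, algebraMap K K' a + algebraMap K K' b * x ∈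
      (1 : Submodule (integralClosure O K') K') →
      a ∈ (1 : Submodule O K) ∧ b ∈ (1 : Submodule O K) := fun a b h ↦ by
    obtain ⟨h1, h2⟩ := (isIntegral_add_mul_iff hπ hx).1 (mem_one_integralClosure.1 h)
    exact ⟨Submodule.mem_one.2 h1, Submodule.mem_one.2 h2⟩
  have hx' : x * x = algebraMap K K' (algebraMap O K π) := by
    rw [← sq, hx, IsScalarTower.algebraMap_apply O K K']
  -- the pairings of `1 ⊗ v + x ⊗ w` with the generators
  have h1 : ∀ v w u, B.baseChange K' (1 ⊗ₜ v + x ⊗ₜ w) (1 ⊗ₜ u) =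
      algebraMap K K' (B v u) + algebraMap K K' (B w u) * x := fun v w u ↦ by
    simp [Algebra.smul_def]
  have h2 : ∀ v w u, B.baseChange K' (1 ⊗ₜ v + x ⊗ₜ w) (x ⊗ₜ u) =
      algebraMap K K' (B (π • w) u) + algebraMap K K' (B v u) * x := fun v w u ↦ by
    simp only [map_add, LinearMap.add_apply, BilinForm.baseChange_tmul, one_mul,
      Algebra.smul_def, hx', LinearMap.map_smul_of_tower, LinearMap.smul_apply, map_mul]
    ring
  have key : ∀ v ∈ Λ, ∀ w ∈ B.dualSubmodule Λ, 1 ⊗ₜ v + x ⊗ₜ w ∈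
      (B.baseChange K').dualSubmodule (ramifiedMidpoint K K' x Λ (B.dualSubmodule Λ)) := by
    intro v hv w hw u hu
    induction hu using Submodule.span_induction with
    | mem u hu =>
      rcases hu with ⟨u, hu, rfl⟩ | ⟨u, hu, rfl⟩
      · change B.baseChange K' _ (1 ⊗ₜ u) ∈ _
        rw [h1]
        exact hint _ _ (hle hv u hu) (hw u hu)
      · change B.baseChange K' _ (x ⊗ₜ u) ∈ _
        rw [h2]
        exact hint _ _ (hdd.ge (hπΛ w hw) u hu) (hdd.ge hv u hu)
    | zero => rw [map_zero]; exact zero_mem _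
    | add u u' _ _ hu hu' => rw [map_add]; exact add_mem hu hu'
    | smul a u _ hu =>
      rw [LinearMap.map_smul_of_tower]
      exact Submodule.smul_mem _ a hu
  apply le_antisymm
  · intro z hz
    obtain ⟨v, w, rfl⟩ := exists_tmul_add_tmul hspan z
    have hz1 : ∀ u ∈ Λ, _ := fun u hu ↦
      hint' _ _ (h1 v w u ▸ hz _ (one_tmul_mem_ramifiedMidpoint hu))
    have hz2 : ∀ u ∈ B.dualSubmodule Λ, _ := fun u hu ↦
      hint' _ _ (h2 v w u ▸ hz _ (tmul_mem_ramifiedMidpoint hu))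
    exact add_mem (one_tmul_mem_ramifiedMidpoint (hdd.le fun u hu ↦ (hz2 u hu).2))
      (tmul_mem_ramifiedMidpoint fun u hu ↦ (hz1 u hu).2)
  · refine Submodule.span_le.2 ?_
    rintro _ (⟨v, hv, rfl⟩ | ⟨v, hv, rfl⟩)
    · simpa using key v hv 0 (zero_mem _)
    · simpa using key 0 (zero_mem _) v hv

lemma exists_selfDual_lattice_baseChange [CharZero K] [FiniteDimensional K K']
    [FiniteDimensional K V] {G : Type*} [Group G]
    (hπ : Irreducible π) (hx : x ^ 2 = algebraMap O K' π)
    (hspan : ∀ y : K', ∃ a b : K, y = algebraMap K K' a + algebraMap K K' b * x)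
    (ρ : Representation K G V) (θ : G →* G) (s : G)
    (hs : θ s = s) (hθ : ∀ g, θ (θ g) = s * g * s⁻¹)
    (e : Representation.Equiv (MonoidHom.comp ρ θ : Representation K G V) ρ.dual)
    (Λ₀ : Submodule O V) (hlat : Submodule.IsLattice K Λ₀) (hΛ₀ : IsStableUnder ρ Λ₀) :
    ∃ N : Submodule (integralClosure O K') (K' ⊗[K] V), Submodule.IsLattice K' N ∧
      ∃ hN : IsStableUnder (baseChangeRep K' ρ) N,
        Nonempty (Representation.Equiv
          (MonoidHom.comp (latticeRep (baseChangeRep K' ρ) N hN) θ :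
            Representation (integralClosure O K') G N)
          (latticeRep (baseChangeRep K' ρ) N hN).dual) := by
  let B₀ : BilinForm K V := e.toLinearEquiv.toLinearMap
  have hB₀ : B₀.Nondegenerate := BilinForm.Nondegenerate.ofSeparatingLeft fun v hv ↦
    e.toLinearEquiv.injective (by rw [map_zero]; exact LinearMap.ext hv)
  have hinv₀ : ∀ g v w, B₀ (ρ (θ g) v) (ρ g w) = B₀ v w := fun g v w ↦ by
    have h := LinearMap.congr_fun (LinearMap.congr_fun (e.isIntertwining' g) v) (ρ g w)
    refine h.trans ?_
    change B₀ v (ρ g⁻¹ (ρ g w)) = _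
    rw [← Module.End.mul_apply, ← map_mul, inv_mul_cancel, map_one, Module.End.one_apply]
  obtain ⟨B, Λ, hB, hinv, hΛ, hst, hdst, hle, hπΛ, hdd⟩ :=
    exists_stable_lattice_le_dual hπ ρ θ s hs hθ hB₀ hinv₀ Λ₀ hΛ₀
  let N := ramifiedMidpoint K K' x Λ (B.dualSubmodule Λ)
  have hNlat : Submodule.IsLattice K' N :=
    isLattice_ramifiedMidpoint (Submodule.IsLattice.dualSubmodule hB Λ).fg
  have hN : IsStableUnder (baseChangeRep K' ρ) N := isStableUnder_ramifiedMidpoint hst hdst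
  have hinv' : ∀ g z z', B.baseChange K' (baseChangeRep K' ρ (θ g) z) (baseChangeRep K' ρ g z') =
      B.baseChange K' z z' := by
    intro g z z'
    induction z using TensorProduct.induction_on with
    | zero => simp
    | add z₁ z₂ h₁ h₂ => simp only [map_add, LinearMap.add_apply, h₁, h₂]
    | tmul a v =>
      induction z' using TensorProduct.induction_on with
      | zero => simp
      | add z₁ z₂ h₁ h₂ => simp only [map_add, h₁, h₂]
      | tmul b w =>
        change B.baseChange K' (a ⊗ₜ ρ (θ g) v) (b ⊗ₜ ρ g w) = _
        rw [BilinForm.baseChange_tmul, BilinForm.baseChange_tmul, hinv]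
  have : IsFractionRing (integralClosure O K') K' :=
    integralClosure.isFractionRing_of_finite_extension K K'
  obtain ⟨φ, hφ⟩ := exists_linearEquiv_dual_of_dualSubmodule_eq
    (baseChange_nondegenerate_of_sq_eq hπ hx hspan hB) N
    (dualSubmodule_ramifiedMidpoint hπ hx hspan hle hπΛ hdd)
  refine ⟨N, hNlat, hN, ⟨Representation.Equiv.mk φ fun g ↦ ?_⟩⟩
  refine LinearMap.ext fun v ↦ LinearMap.ext fun w ↦ ?_
  apply FaithfulSMul.algebraMap_injective (integralClosure O K') K'
  change algebraMap _ K' (φ (latticeRep (baseChangeRep K' ρ) N hN (θ g) v) w) =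
    algebraMap _ K' (φ v (latticeRep (baseChangeRep K' ρ) N hN g⁻¹ w))
  rw [hφ, hφ]
  change B.baseChange K' (baseChangeRep K' ρ (θ g) v) w =
    B.baseChange K' v (baseChangeRep K' ρ g⁻¹ w)
  rw [← hinv' g v, ← Module.End.mul_apply, ← map_mul, mul_inv_cancel, map_one,
    Module.End.one_apply]

end RamifiedBaseChange

/-! ### Conjugation by a lift -/

section GaloisConjugation

variable {F E Ω : Type*} [Field F] [Field E] [Field Ω] [Algebra F E] [Algebra F Ω] [Algebra E Ω]

/-- The square `γ²` of a lift of an involution is an element of `Gal(Ω/E)`, is fixed by conjugation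
by `γ`, and induces the square of that conjugation. -/
lemma exists_sq_lift {c : E ≃ₐ[F] E} (hc : ∀ x, c (c x) = x) {γ : Ω ≃ₐ[F] Ω}
    (hγ : ∀ x : E, γ (algebraMap E Ω x) = algebraMap E Ω (c x)) :
    ∃ s : Ω ≃ₐ[E] Ω, galConj c γ hγ s = s ∧
      ∀ g, galConj c γ hγ (galConj c γ hγ g) = s * g * s⁻¹ := by
  let s : Ω ≃ₐ[E] Ω := AlgEquiv.ofRingEquiv (f := γ.toRingEquiv.trans γ.toRingEquiv) fun x ↦ by
    change γ (γ (algebraMap E Ω x)) = _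
    rw [hγ, hγ, hc]
  refine ⟨s, ?_, fun g ↦ ?_⟩
  · ext y
    change γ (γ (γ (γ.symm y))) = γ (γ y)
    rw [AlgEquiv.apply_symm_apply]
  · rw [eq_mul_inv_iff_mul_eq]
    ext y
    change γ (γ (g (γ.symm (γ.symm (γ (γ y)))))) = γ (γ (g y))
    rw [AlgEquiv.symm_apply_apply, AlgEquiv.symm_apply_apply]

end GaloisConjugation

theorem proposition6p2p2
    -- the CM extension `E/F`, the nontrivial element `c` of `Gal(E/F)`, an algebraic closure of
    -- `E`, and a lift `γ` of `c`
    {F E Ebar : Type*} [Field F] [NumberField F] [NumberField.IsTotallyReal F]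
    [Field E] [NumberField E] [NumberField.IsTotallyComplex E]
    [Algebra F E] [Algebra.IsQuadraticExtension F E]
    [Field Ebar] [Algebra E Ebar] [IsAlgClosure E Ebar] [Algebra F Ebar] [IsScalarTower F E Ebar]
    (c : E ≃ₐ[F] E) (_hc : c ≠ 1)
    (γ : Ebar ≃ₐ[F] Ebar) (hγ : ∀ x : E, γ (algebraMap E Ebar x) = algebraMap E Ebar (c x))
    -- the number field `L ⊂ ℂ`, stable under complex conjugation, and its finite place `μ`
    (L : Subfield ℂ) [NumberField L] (_hL : ∀ x ∈ L, (starRingEnd ℂ) x ∈ L)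
    (μ : IsDedekindDomain.HeightOneSpectrum (𝓞 L))
    -- the representation `τ`
    {V : Type*} [AddCommGroup V] [Module (μ.adicCompletion L) V]
    [Module (μ.adicCompletionIntegers L) V]
    [IsScalarTower (μ.adicCompletionIntegers L) (μ.adicCompletion L) V]
    [FiniteDimensional (μ.adicCompletion L) V]
    (_hd : Module.finrank (μ.adicCompletion L) V ≤ 3)
    (τ : Representation (μ.adicCompletion L) (Ebar ≃ₐ[E] Ebar) V)
    (_hstable : ∃ Λ₀ : Submodule (μ.adicCompletionIntegers L) V,
      Submodule.IsLattice (μ.adicCompletion L) Λ₀ ∧ IsStableUnder τ Λ₀)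
    (_hτ : Nonempty ((conjRep c γ hγ τ).Equiv τ.dual)) :
    ∃ K' : IntermediateField (μ.adicCompletion L) (AlgebraicClosure (μ.adicCompletion L)),
      IsTotallyRamifiedExt (μ.adicCompletionIntegers L) (μ.adicCompletion L) K' ∧
      Module.finrank (μ.adicCompletion L) K' ≤ 3 ∧
      HasConjSelfDualLattice c γ hγ (integralClosure (μ.adicCompletionIntegers L) K')
        (baseChangeRep K' τ) := by
  have hcc : ∀ x, c (c x) = x := fun x ↦ by
    have h : c ^ 2 = 1 := by
      rw [← Algebra.IsQuadraticExtension.finrank_eq_two F E, ← IsGalois.card_aut_eq_finrank]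
      exact pow_card_eq_one'
    exact AlgEquiv.congr_fun (sq c ▸ h) x
  obtain ⟨s, hs, hθ⟩ := exists_sq_lift hcc hγ
  have : CharZero (μ.adicCompletion L) :=
    charZero_of_injective_algebraMap (algebraMap L (μ.adicCompletion L)).injective
  obtain ⟨π, hπ⟩ := IsDiscreteValuationRing.exists_irreducible (μ.adicCompletionIntegers L)
  obtain ⟨K', x, hx, hrank, hspan⟩ := exists_intermediateField_sqrt (K := μ.adicCompletion L) hπ
    (AlgebraicClosure (μ.adicCompletion L))
  obtain ⟨Λ₀, hlat, hΛ₀⟩ := _hstable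
  obtain ⟨e⟩ := _hτ
  have : FiniteDimensional (μ.adicCompletion L) K' := Module.finite_of_finrank_pos (by omega)
  exact ⟨K', isTotallyRamifiedExt_of_sq_eq hπ hx hspan hrank, by omega,
    exists_selfDual_lattice_baseChange hπ hx hspan τ (galConj c γ hγ) s hs hθ e Λ₀ hlat hΛ₀⟩
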